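/- Let $l_1\ge l_2\ge\cdots\ge l_m\ge 0$ be integers that take exactly three distinct values, and let $Y$ be the Young diagram with left-aligned rows of lengths $l_1,\dots,l_m$ from top to bottom. Suppose that $Y$ is wide: for every diagram $Z$ formed by a subset of the rows of $Y$, $Z$ dominates its conjugate $Z'$, i.e. for every $k\ge 0$ the sum of the lengths of the first $k$ rows of $Z$ is at least the sum of the lengths of the first $k$ columns of $Z$. Then $Y$ is Latin: its cells can be filled with integers so that, for every $i$, the row of length $l_i$ contains exactly the symbols $1,\dots,l_i$ (each once), and no symbol is repeated in a column. -/

import Mathlib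

/-!
A filling of `μ` is a partial colouring of the square columns × symbols by the rows of `μ`: the cell
`(j, s)` gets colour `i` if row `i` has symbol `s` in column `j`. The filling is Latin when the
colour of a row of length `l` is a perfect matching of the first `l` columns with the first `l`
symbols. Amalgamating the rows of equal length into one colour, and the columns and symbols between
two consecutive lengths into one block, leaves a small table of numbers, the outline. Conversely,
an integral transport argument (a form of Hall's theorem) detaches any outline into a partial
colouring of the square, and splits every regular colour of it into perfect matchings.

For three lengths the outline is a 3 × 3 table in three colours. The colour of the shortest rows is
forced into the corner block, the middle colour is determined by the size `b` of its off-diagonal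
blocks, and the colour of the longest rows is a transport into the remaining cells. With `b` as
large as possible, the cut conditions of that transport problem follow from wideness.
-/

namespace YoungDiagram

/-- The dominance order on partitions of the same number: `μ` dominates `ν` if they have equally
many cells and, for every `k`, the top `k` rows of `μ` have in total at least as many cells as the
top `k` rows of `ν`. -/
def Dominates (μ ν : YoungDiagram) : Prop :=
  μ.card = ν.card ∧
    ∀ k : ℕ, ∑ i ∈ Finset.range k, ν.rowLen i ≤ ∑ i ∈ Finset.range k, μ.rowLen i

/-- `ν` is (the shape of) a subdiagram formed by a subset of the rows of `μ`: its list of row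
lengths is obtained from that of `μ` by deleting entries. -/
def IsRowSubdiagram (ν μ : YoungDiagram) : Prop :=
  ν.rowLens.Sublist μ.rowLens

/-- A Young diagram is wide if every subdiagram formed by a subset of its rows dominates its
conjugate. -/
def IsWide (μ : YoungDiagram) : Prop :=
  ∀ ν : YoungDiagram, ν.IsRowSubdiagram μ → ν.Dominates ν.transpose

/-- `f` is a Latin filling of `μ` (values of `f` outside `μ` are irrelevant): the row of length `l`
is populated by `1, …, l`, and `f` is injective on each column. As a row of length `l` has `l`
cells, each of `1, …, l` occurs in it exactly once. -/
def IsLatinFilling (μ : YoungDiagram) (f : ℕ × ℕ → ℕ) : Prop :=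
  (∀ i, (μ.row i).image f = Finset.Icc 1 (μ.rowLen i)) ∧
    ∀ j, Set.InjOn f (μ.col j : Set (ℕ × ℕ))

/-- A Young diagram is Latin if it has a Latin filling. -/
def IsLatin (μ : YoungDiagram) : Prop :=
  ∃ f : ℕ × ℕ → ℕ, μ.IsLatinFilling f

end YoungDiagram

theorem exists_transport {ι β : Type*} [Fintype ι] [Fintype β] [DecidableEq β]
    (t : ι → Finset β) (m : ι → ℕ) (k : β → ℕ) (hsum : ∑ i, m i = ∑ b, k b)
    (hall : ∀ s : Finset ι, ∑ i ∈ s, m i ≤ ∑ b ∈ s.biUnion t, k b) :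
    ∃ F : ι → β → ℕ, (∀ i, ∀ b ∉ t i, F i b = 0) ∧ (∀ i, ∑ b, F i b = m i) ∧
      ∀ b, ∑ i, F i b = k b := by
  classical
  let T : (Σ i, Fin (m i)) → Finset (Σ b, Fin (k b)) := fun a => (t a.1).sigma fun _ => Finset.univ
  have hallT : ∀ s : Finset (Σ i, Fin (m i)), s.card ≤ (s.biUnion T).card := fun s => by
    calc s.card ≤ ((s.image Sigma.fst).sigma fun _ => Finset.univ).card :=
          Finset.card_le_card fun a ha => by simpa using ⟨_, ha⟩
      _ = ∑ i ∈ s.image Sigma.fst, m i := by simp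
      _ ≤ ∑ b ∈ (s.image Sigma.fst).biUnion t, k b := hall _
      _ = (((s.image Sigma.fst).biUnion t).sigma
            fun b => (Finset.univ : Finset (Fin (k b)))).card := by simp
      _ = (s.biUnion T).card := by
          congr 1
          ext y
          simp [T]
  obtain ⟨f, hinj, hf⟩ := (Finset.all_card_le_biUnion_card_iff_exists_injective T).1 hallT
  have hbij : Function.Bijective f :=
    (Fintype.bijective_iff_injective_and_card f).2 ⟨hinj, by simpa using hsum⟩
  refine ⟨fun i b => ∑ a, if (f ⟨i, a⟩).1 = b then 1 else 0, fun i b hb => ?_, fun i => ?_,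
    fun b => ?_⟩
  · refine Finset.sum_eq_zero fun a _ => if_neg ?_
    rintro rfl
    exact hb (Finset.mem_sigma.1 (hf ⟨i, a⟩)).1
  · rw [Finset.sum_comm]
    simp
  · calc ∑ i, ∑ a, (if (f ⟨i, a⟩).1 = b then 1 else 0)
        = ∑ a, if (f a).1 = b then 1 else 0 := by rw [Fintype.sum_sigma]
      _ = ∑ y : Σ b, Fin (k b), if y.1 = b then 1 else 0 :=
          hbij.sum_comp fun y => if y.1 = b then 1 else 0
      _ = ∑ b', ∑ _a : Fin (k b'), if b' = b then 1 else 0 := Fintype.sum_sigma _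
      _ = k b := by simp

theorem exists_add_eq_of_sum_eq {α β : Type*} [Fintype α] [Fintype β] (u : α → β → ℕ)
    (r : α → ℕ) (d : β → ℕ) (hsum : ∑ i, ∑ j, u i j = ∑ i, r i + ∑ j, d j)
    (hall : ∀ (R : Finset α) (S : Finset β),
      ∑ i ∈ R, ∑ j ∈ S, u i j ≤ ∑ i ∈ R, r i + ∑ j ∈ S, d j) :
    ∃ x y : α → β → ℕ, (∀ i j, x i j + y i j = u i j) ∧ (∀ i, ∑ j, x i j = r i) ∧
      ∀ j, ∑ i, y i j = d j := by
  classical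
  let t : α × β → Finset (α ⊕ β) := fun e => {.inl e.1, .inr e.2}
  have htotal : ∑ e : α × β, u e.1 e.2 = ∑ b, Sum.elim r d b := by
    simpa [Fintype.sum_prod_type] using hsum
  have hallt : ∀ s : Finset (α × β), ∑ e ∈ s, u e.1 e.2 ≤ ∑ b ∈ s.biUnion t, Sum.elim r d b :=
      fun s => by
    have hst : s.biUnion t = (s.image Prod.fst).disjSum (s.image Prod.snd) := by
      ext (i | j) <;> simp [t, eq_comm]
    calc ∑ e ∈ s, u e.1 e.2
        ≤ ∑ e ∈ s.image Prod.fst ×ˢ s.image Prod.snd, u e.1 e.2 :=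
          Finset.sum_le_sum_of_subset Finset.subset_product
      _ = ∑ i ∈ s.image Prod.fst, ∑ j ∈ s.image Prod.snd, u i j := Finset.sum_product' ..
      _ ≤ ∑ i ∈ s.image Prod.fst, r i + ∑ j ∈ s.image Prod.snd, d j := hall _ _
      _ = ∑ b ∈ s.biUnion t, Sum.elim r d b := by rw [hst, Finset.sum_disjSum]; rfl
  obtain ⟨F, hF, hFe, hFb⟩ := exists_transport t _ _ htotal hallt
  refine ⟨fun i j => F (i, j) (.inl i), fun i j => F (i, j) (.inr j), fun i j => ?_, fun i => ?_,
    fun j => ?_⟩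
  · rw [← hFe (i, j), ← Finset.sum_pair Sum.inl_ne_inr]
    exact Finset.sum_subset (Finset.subset_univ _) fun b _ hb => hF _ b hb
  · have hoff : ∀ i' ≠ i, ∑ j, F (i', j) (.inl i) = 0 := fun i' hi =>
      Finset.sum_eq_zero fun j _ => hF (i', j) (.inl i) (by simp [t, hi.symm])
    rw [← Sum.elim_inl r d i, ← hFb, Fintype.sum_prod_type, Fintype.sum_eq_single i hoff]
  · have hoff : ∀ j' ≠ j, ∑ i, F (i, j') (.inr j) = 0 := fun j' hj =>
      Finset.sum_eq_zero fun i _ => hF (i, j') (.inr j) (by simp [t, hj.symm])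
    rw [← Sum.elim_inr r d j, ← hFb, Fintype.sum_prod_type_right, Fintype.sum_eq_single j hoff]

theorem exists_capacitated_transport {α β : Type*} [Fintype α] [Fintype β]
    (u : α → β → ℕ) (r : α → ℕ) (d : β → ℕ) (hsum : ∑ i, r i = ∑ j, d j)
    (hcut : ∀ (R : Finset α) (S : Finset β),
      ∑ i ∈ R, r i + ∑ j ∈ S, d j ≤ ∑ i, r i + ∑ i ∈ R, ∑ j ∈ S, u i j) :
    ∃ x : α → β → ℕ, (∀ i j, x i j ≤ u i j) ∧ (∀ i, ∑ j, x i j = r i) ∧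
      ∀ j, ∑ i, x i j = d j := by
  classical
  have hr : ∀ i, r i ≤ ∑ j, u i j := fun i => by
    have := hcut {i} Finset.univ
    rw [← hsum, Finset.sum_singleton, Finset.sum_singleton] at this
    omega
  have hslack : ∀ R : Finset α,
      ∑ i ∈ R, (∑ j, u i j - r i) + ∑ i ∈ R, r i = ∑ i ∈ R, ∑ j, u i j := fun R => by
    rw [← Finset.sum_add_distrib]
    exact Finset.sum_congr rfl fun i _ => Nat.sub_add_cancel (hr i)
  -- Each of the `u i j` units goes either to the column `j` or, as slack, to the row `i`.
  obtain ⟨y, x, hyx, hy, hx⟩ := exists_add_eq_of_sum_eq u (fun i => ∑ j, u i j - r i) d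
    (by rw [← hsum, hslack]) fun R S => by
      have hrow : ∑ i ∈ R, ∑ j, u i j = ∑ i ∈ R, ∑ j ∈ S, u i j + ∑ i ∈ R, ∑ j ∈ Sᶜ, u i j := by
        simp only [← Finset.sum_add_distrib, Finset.sum_add_sum_compl]
      have hcol := Finset.sum_add_sum_compl S d
      have hRS := hcut R Sᶜ
      have := hslack R
      omega
  refine ⟨x, fun i j => hyx i j ▸ Nat.le_add_left _ _, fun i => ?_, hx⟩
  have hi : ∑ j, y i j + ∑ j, x i j = ∑ j, u i j := by
    simp only [← Finset.sum_add_distrib, hyx]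
  have := hr i
  have := hy i
  omega

theorem sum_rows_add_sum_cols_le {α β : Type*} [Fintype α] [Fintype β] (M : α → β → ℕ)
    (R : Finset α) (S : Finset β) :
    ∑ i ∈ R, ∑ j, M i j + ∑ j ∈ S, ∑ i, M i j ≤ ∑ i, ∑ j, M i j + ∑ i ∈ R, ∑ j ∈ S, M i j := by
  classical
  have hR : ∑ i ∈ R, ∑ j, M i j = ∑ i ∈ R, ∑ j ∈ S, M i j + ∑ i ∈ R, ∑ j ∈ Sᶜ, M i j := by
    simp only [← Finset.sum_add_distrib, Finset.sum_add_sum_compl]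
  have htotal : ∑ i, ∑ j, M i j = ∑ j ∈ S, ∑ i, M i j + ∑ i, ∑ j ∈ Sᶜ, M i j := by
    rw [Finset.sum_comm (s := S), ← Finset.sum_add_distrib]
    simp only [Finset.sum_add_sum_compl]
  have hle : ∑ i ∈ R, ∑ j ∈ Sᶜ, M i j ≤ ∑ i, ∑ j ∈ Sᶜ, M i j :=
    Finset.sum_le_univ_sum_of_nonneg fun _ => Nat.zero_le _
  omega

theorem exists_share {α β : Type*} [Fintype α] [Fintype β] {n : ℕ} (hn : 0 < n)
    (ρ : α → ℕ) (σ : β → ℕ) (M : α → β → ℕ)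
    (hρ : ∀ i, ∑ j, M i j = n * ρ i) (hσ : ∀ j, ∑ i, M i j = n * σ j) :
    ∃ x : α → β → ℕ, (∀ i j, x i j ≤ M i j) ∧ (∀ i, ∑ j, x i j = ρ i) ∧
      ∀ j, ∑ i, x i j = σ j := by
  have hsum : ∑ i, ρ i = ∑ j, σ j := by
    have : ∑ i, ∑ j, M i j = ∑ j, ∑ i, M i j := Finset.sum_comm
    simp only [hρ, hσ, ← Finset.mul_sum] at this
    exact Nat.eq_of_mul_eq_mul_left hn this
  refine exists_capacitated_transport M ρ σ hsum fun R S => Nat.le_of_mul_le_mul_left ?_ hn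
  calc n * (∑ i ∈ R, ρ i + ∑ j ∈ S, σ j)
      = ∑ i ∈ R, ∑ j, M i j + ∑ j ∈ S, ∑ i, M i j := by simp only [hρ, hσ, mul_add, Finset.mul_sum]
    _ ≤ ∑ i, ∑ j, M i j + ∑ i ∈ R, ∑ j ∈ S, M i j := sum_rows_add_sum_cols_le M R S
    _ ≤ ∑ i, ∑ j, M i j + n * ∑ i ∈ R, ∑ j ∈ S, M i j := by
        gcongr
        exact Nat.le_mul_of_pos_left _ hn
    _ = n * (∑ i, ρ i + ∑ i ∈ R, ∑ j ∈ S, M i j) := by simp only [hρ, mul_add, Finset.mul_sum]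

theorem exists_balanced_decomposition {α β γ : Type*} [Fintype α] [Fintype β]
    (s : Finset γ) (ρ : α → ℕ) (σ : β → ℕ) (M : α → β → ℕ)
    (hρ : ∀ i, ∑ j, M i j = s.card * ρ i) (hσ : ∀ j, ∑ i, M i j = s.card * σ j) :
    ∃ D : γ → α → β → ℕ, (∀ i j, ∑ k ∈ s, D k i j = M i j) ∧
      (∀ k ∈ s, ∀ i, ∑ j, D k i j = ρ i) ∧ ∀ k ∈ s, ∀ j, ∑ i, D k i j = σ j := by
  classical
  induction s using Finset.induction_on generalizing M with
  | empty =>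
    have hM : ∀ i j, M i j = 0 := by simpa [Finset.sum_eq_zero_iff] using hρ
    exact ⟨fun _ _ _ => 0, by simp [hM], by simp, by simp⟩
  | insert a s ha ih =>
    obtain ⟨x, hx, hxρ, hxσ⟩ := exists_share (Finset.card_pos.2 ⟨a, by simp⟩) ρ σ M hρ hσ
    rw [Finset.card_insert_of_notMem ha] at hρ hσ
    obtain ⟨D, hD, hDρ, hDσ⟩ := ih (fun i j => M i j - x i j)
      (fun i => by
        rw [Finset.sum_tsub_distrib _ fun j _ => hx i j, hxρ, hρ, add_one_mul,
          Nat.add_sub_cancel])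
      (fun j => by
        rw [Finset.sum_tsub_distrib _ fun i _ => hx i j, hxσ, hσ, add_one_mul,
          Nat.add_sub_cancel])
    have hne : ∀ k ∈ s, k ≠ a := fun k hk hka => ha (hka ▸ hk)
    refine ⟨Function.update D a x, fun i j => ?_, ?_, ?_⟩
    · rw [Finset.sum_insert ha, Function.update_self,
        Finset.sum_congr rfl fun k hk => by rw [Function.update_of_ne (hne k hk)], hD,
        Nat.add_sub_cancel' (hx i j)]
    · rw [Finset.forall_mem_insert, Function.update_self]
      exact ⟨hxρ, fun k hk => by rw [Function.update_of_ne (hne k hk)]; exact hDρ k hk⟩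
    · rw [Finset.forall_mem_insert, Function.update_self]
      exact ⟨hxσ, fun k hk => by rw [Function.update_of_ne (hne k hk)]; exact hDσ k hk⟩

theorem exists_detachment {α β I J X : Type*} [Fintype α] [Fintype β] [Fintype I] [Fintype J]
    [Fintype X] [DecidableEq I] [DecidableEq J] (φ : α → I) (ψ : β → J) (N : I → J → X → ℕ)
    (ρ : I → X → ℕ) (σ : J → X → ℕ)
    (hN : ∀ i j, ∑ x, N i j x = Fintype.card {k // φ k = i} * Fintype.card {l // ψ l = j})
    (hρ : ∀ i x, ∑ j, N i j x = Fintype.card {k // φ k = i} * ρ i x)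
    (hσ : ∀ j x, ∑ i, N i j x = Fintype.card {l // ψ l = j} * σ j x) :
    ∃ A : α → β → X → ℕ, (∀ k l, ∑ x, A k l x = 1) ∧
      (∀ k x, ∑ l, A k l x = ρ (φ k) x) ∧ ∀ l x, ∑ k, A k l x = σ (ψ l) x := by
  have hrows : ∀ i, ∃ D : {k // φ k = i} → J → X → ℕ, (∀ j x, ∑ k, D k j x = N i j x) ∧
      (∀ k j, ∑ x, D k j x = Fintype.card {l // ψ l = j}) ∧ ∀ k x, ∑ j, D k j x = ρ i x :=
    fun i => by simpa using exists_balanced_decomposition Finset.univ _ _ _ (hN i) (hρ i)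
  choose D hD hDcell hDrow using hrows
  have hcols : ∀ j, ∃ F : {l // ψ l = j} → α → X → ℕ,
      (∀ k x, ∑ l, F l k x = D (φ k) ⟨k, rfl⟩ j x) ∧
      (∀ l k, ∑ x, F l k x = 1) ∧ ∀ l x, ∑ k, F l k x = σ j x := by
    intro j
    have hDcol : ∀ x, ∑ k, D (φ k) ⟨k, rfl⟩ j x = Fintype.card {l // ψ l = j} * σ j x := fun x => by
      rw [← hσ, ← Fintype.sum_fiberwise φ]
      refine Finset.sum_congr rfl fun i _ => ?_
      rw [← hD]
      refine Finset.sum_congr rfl ?_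
      rintro ⟨k, rfl⟩ _
      rfl
    simpa using exists_balanced_decomposition Finset.univ (fun _ => 1) (σ j)
      (fun k x => D (φ k) ⟨k, rfl⟩ j x) (by simp [hDcell]) hDcol
  choose F hF hFcell hFcol using hcols
  refine ⟨fun k l x => F (ψ l) ⟨l, rfl⟩ k x, fun k l => hFcell _ _ _, fun k x => ?_,
    fun l x => hFcol _ _ _⟩
  rw [← hDrow (φ k) ⟨k, rfl⟩ x, ← Fintype.sum_fiberwise ψ]
  refine Finset.sum_congr rfl fun j _ => ?_
  rw [← hF]
  refine Finset.sum_congr rfl ?_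
  rintro ⟨l, rfl⟩ _
  rfl

/-- The right end of the block `x` when consecutive blocks have widths `w 0, w 1, …`. -/
def blockEnd {n : ℕ} (w : Fin n → ℕ) (x : Fin n) : ℕ :=
  ∑ y ∈ Finset.Iic x, w y

/-- The block that contains the position `k` when consecutive blocks have widths `w 0, w 1, …`. -/
def blockIndex {n : ℕ} (w : Fin n → ℕ) (k : Fin (∑ x, w x)) : Fin n :=
  (finSigmaFinEquiv.symm k).1

theorem card_blockIndex_eq {n : ℕ} (w : Fin n → ℕ) (x : Fin n) :
    Fintype.card {k // blockIndex w k = x} = w x := by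
  rw [← Fintype.card_fin (w x)]
  exact Fintype.card_congr <|
    (finSigmaFinEquiv.symm.subtypeEquiv fun _ => Iff.rfl).trans (Equiv.sigmaSubtype x)

theorem blockIndex_le_iff {n : ℕ} (w : Fin n → ℕ) (k : Fin (∑ x, w x)) (x : Fin n) :
    blockIndex w k ≤ x ↔ (k : ℕ) < blockEnd w x := by
  obtain ⟨⟨y, m⟩, rfl⟩ := finSigmaFinEquiv.surjective k
  have hstart : ∑ z : Fin y, w (z.castLE y.2.le) = ∑ z ∈ Finset.Iio y, w z := by
    rw [← Finset.sum_image (g := Fin.castLE y.2.le) (Fin.castLE_injective _).injOn]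
    congr 1
    ext z
    simp only [Finset.mem_image, Finset.mem_univ, true_and, Finset.mem_Iio]
    exact ⟨fun ⟨z', hz⟩ => hz ▸ z'.2, fun hz => ⟨⟨z, hz⟩, rfl⟩⟩
  have hend : ∑ z ∈ Finset.Iio y, w z + w y = blockEnd w y := by
    rw [blockEnd, ← Finset.add_sum_Iio_eq_sum_Iic, add_comm]
  rw [blockIndex, Equiv.symm_apply_apply, finSigmaFinEquiv_apply, hstart]
  have hm := m.2
  refine ⟨fun hyx => ?_, fun hlt => ?_⟩
  · have : blockEnd w y ≤ blockEnd w x :=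
      Finset.sum_le_sum_of_subset (Finset.Iic_subset_Iic.2 hyx)
    dsimp only
    omega
  · by_contra! hxy
    have : blockEnd w x ≤ ∑ z ∈ Finset.Iio y, w z :=
      Finset.sum_le_sum_of_subset fun z hz => by
        rw [Finset.mem_Iio]
        exact (Finset.mem_Iic.1 hz).trans_lt hxy
    dsimp only at hlt
    omega

/-- The outline (amalgamation) of a partial colouring of a square that is divided into blocks of
sides `w i` in both directions: colour `x` occurs `mult x` times in every row and every column of
the blocks `i ≤ x` and nowhere else, and `N i j x` counts its cells in the block `(i, j)`. -/
structure IsOutline {n : ℕ} (w mult : Fin n → ℕ) (N : Fin n → Fin n → Fin n → ℕ) : Prop where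
  cell_le : ∀ i j, ∑ x, N i j x ≤ w i * w j
  row_sum : ∀ i x, ∑ j, N i j x = w i * if i ≤ x then mult x else 0
  col_sum : ∀ j x, ∑ i, N i j x = w j * if j ≤ x then mult x else 0

theorem exists_partial_detachment {α β I J X : Type*} [Fintype α] [Fintype β] [Fintype I]
    [Fintype J] [Fintype X] [DecidableEq I] [DecidableEq J] (φ : α → I) (ψ : β → J)
    (N : I → J → X → ℕ) (ρ : I → X → ℕ) (σ : J → X → ℕ)
    (hN : ∀ i j, ∑ x, N i j x ≤ Fintype.card {k // φ k = i} * Fintype.card {l // ψ l = j})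
    (hρ : ∀ i x, ∑ j, N i j x = Fintype.card {k // φ k = i} * ρ i x)
    (hσ : ∀ j x, ∑ i, N i j x = Fintype.card {l // ψ l = j} * σ j x) :
    ∃ A : α → β → X → ℕ, (∀ k l, ∑ x, A k l x ≤ 1) ∧
      (∀ k x, ∑ l, A k l x = ρ (φ k) x) ∧ ∀ l x, ∑ k, A k l x = σ (ψ l) x := by
  let m i := Fintype.card {k // φ k = i}
  let m' j := Fintype.card {l // ψ l = j}
  let blank i j := m i * m' j - ∑ x, N i j x
  have hα : ∑ i, m i = Fintype.card α := by
    rw [← Fintype.card_sigma, Fintype.card_congr (Equiv.sigmaFiberEquiv φ)]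
  have hβ : ∑ j, m' j = Fintype.card β := by
    rw [← Fintype.card_sigma, Fintype.card_congr (Equiv.sigmaFiberEquiv ψ)]
  have hblank_row : ∀ i, ∑ j, blank i j = m i * (Fintype.card β - ∑ x, ρ i x) := fun i => by
    rw [Finset.sum_tsub_distrib _ fun j _ => hN i j, Finset.sum_comm, ← Finset.mul_sum, hβ]
    simp only [hρ]
    rw [← Finset.mul_sum, ← Nat.mul_sub]
  have hblank_col : ∀ j, ∑ i, blank i j = m' j * (Fintype.card α - ∑ x, σ j x) := fun j => by
    rw [Finset.sum_tsub_distrib _ fun i _ => hN i j, Finset.sum_comm, ← Finset.sum_mul, hα]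
    simp only [hσ]
    rw [← Finset.mul_sum, mul_comm, ← Nat.mul_sub]
  obtain ⟨A, hA, hAρ, hAσ⟩ := exists_detachment φ ψ (fun i j y => y.elim (blank i j) (N i j))
    (fun i y => y.elim (Fintype.card β - ∑ x, ρ i x) (ρ i))
    (fun j y => y.elim (Fintype.card α - ∑ x, σ j x) (σ j))
    (fun i j => by rw [Fintype.sum_option]; exact Nat.sub_add_cancel (hN i j))
    (fun i => Option.forall.2 ⟨hblank_row i, hρ i⟩) (fun j => Option.forall.2 ⟨hblank_col j, hσ j⟩)
  refine ⟨fun k l x => A k l (some x), fun k l => ?_, fun k x => hAρ k (some x),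
    fun l x => hAσ l (some x)⟩
  rw [← hA k l, Fintype.sum_option]
  exact Nat.le_add_left _ _

theorem isLatin_of_injOn (μ : YoungDiagram) (f : ℕ → ℕ → ℕ)
    (hlt : ∀ i, ∀ j < μ.rowLen i, f i j < μ.rowLen i)
    (hrow : ∀ i, Set.InjOn (f i) (Set.Iio (μ.rowLen i)))
    (hcol : ∀ j, Set.InjOn (fun i => f i j) (Set.Iio (μ.colLen j))) : μ.IsLatin := by
  refine ⟨fun x => f x.1 x.2 + 1, fun i => ?_, fun j => ?_⟩
  · have himage : (μ.row i).image (fun x => f x.1 x.2 + 1) =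
        (Finset.range (μ.rowLen i)).image fun j => f i j + 1 := by
      rw [YoungDiagram.row_eq_prod, Finset.singleton_product, Finset.map_eq_image,
        Finset.image_image]
      rfl
    rw [himage]
    refine Finset.eq_of_subset_of_card_le (Finset.image_subset_iff.2 fun j hj => ?_) ?_
    · have := hlt i j (Finset.mem_range.1 hj)
      exact Finset.mem_Icc.2 (by omega)
    · rw [Finset.card_image_of_injOn, Finset.card_range, Nat.card_Icc, Nat.add_sub_cancel]
      rw [Finset.coe_range]
      exact fun j hj j' hj' h => hrow i hj hj' (Nat.succ_injective h)
  · rintro ⟨i, j₁⟩ hi ⟨i', j₂⟩ hi' h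
    rw [Finset.mem_coe, YoungDiagram.mem_col_iff, YoungDiagram.mem_iff_lt_colLen] at hi hi'
    obtain ⟨hi, rfl⟩ := hi
    obtain ⟨hi', rfl : j₂ = j₁⟩ := hi'
    rw [hcol j₂ hi hi' (Nat.succ_injective h)]

theorem eq_of_sum_le_one {ι : Type*} {s : Finset ι} {f : ι → ℕ} (hf : ∑ i ∈ s, f i ≤ 1) {i j : ι}
    (hi : i ∈ s) (hj : j ∈ s) (hfi : f i ≠ 0) (hfj : f j ≠ 0) : i = j := by
  by_contra hij
  have := Finset.add_le_sum (fun _ _ => Nat.zero_le _) hi hj hij (f := f)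
  omega

theorem isLatin_of_disjoint_matchings (μ : YoungDiagram) {a : ℕ}
    (ha : ∀ i < μ.colLen 0, μ.rowLen i ≤ a) (D : ℕ → Fin a → Fin a → ℕ)
    (hcol : ∀ i < μ.colLen 0, ∀ j, ∑ s, D i j s = if (j : ℕ) < μ.rowLen i then 1 else 0)
    (hsym : ∀ i < μ.colLen 0, ∀ s, ∑ j, D i j s = if (s : ℕ) < μ.rowLen i then 1 else 0)
    (hD : ∀ j s, ∑ i ∈ Finset.range (μ.colLen 0), D i j s ≤ 1) : μ.IsLatin := by
  have hlt : ∀ i j, j < μ.rowLen i → i < μ.colLen 0 := fun i j hj =>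
    YoungDiagram.mem_iff_lt_colLen.1 (YoungDiagram.mem_iff_lt_rowLen.2 (Nat.zero_lt_of_lt hj))
  have hex : ∀ i j, ∃ s, ∀ hj : j < μ.rowLen i, s < μ.rowLen i ∧
      ∃ hs : s < a, D i ⟨j, hj.trans_le (ha i (hlt i j hj))⟩ ⟨s, hs⟩ ≠ 0 := by
    refine fun i j => (em (j < μ.rowLen i)).elim (fun hj => ?_) fun hj => ⟨0, fun h => (hj h).elim⟩
    have hsum := (hcol i (hlt i j hj) ⟨j, hj.trans_le (ha i (hlt i j hj))⟩).trans_ne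
      (by rw [if_pos hj]; exact one_ne_zero)
    obtain ⟨s, -, hs⟩ := Finset.exists_ne_zero_of_sum_ne_zero hsum
    refine ⟨s, fun _ => ⟨?_, s.2, hs⟩⟩
    by_contra hlts
    have hsum_s := hsym i (hlt i j hj) s
    rw [if_neg hlts, Finset.sum_eq_zero_iff] at hsum_s
    exact hs (hsum_s _ (Finset.mem_univ _))
  choose f hf using hex
  refine isLatin_of_injOn μ f (fun i j hj => (hf i j hj).1) (fun i j hj j' hj' h => ?_)
    fun j i hi i' hi' h => ?_
  · obtain ⟨-, hs, hDj⟩ := hf i j hj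
    obtain ⟨-, hs', hDj'⟩ := hf i j' hj'
    simp only [← h] at hDj'
    have hle : ∑ j', D i j' ⟨f i j, hs⟩ ≤ 1 := by
      rw [hsym i (hlt i j hj)]
      split_ifs <;> simp
    simpa using eq_of_sum_le_one hle (Finset.mem_univ _) (Finset.mem_univ _) hDj hDj'
  · have hj : j < μ.rowLen i :=
      YoungDiagram.mem_iff_lt_rowLen.1 (YoungDiagram.mem_iff_lt_colLen.2 hi)
    have hj' : j < μ.rowLen i' :=
      YoungDiagram.mem_iff_lt_rowLen.1 (YoungDiagram.mem_iff_lt_colLen.2 hi')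
    obtain ⟨-, hs, hDi⟩ := hf i j hj
    obtain ⟨-, hs', hDi'⟩ := hf i' j hj'
    simp only [← h] at hDi'
    exact eq_of_sum_le_one (hD _ _) (Finset.mem_range.2 (hlt i j hj))
      (Finset.mem_range.2 (hlt i' j hj')) hDi hDi'

theorem isLatin_of_isOutline (μ : YoungDiagram) {n : ℕ} {w : Fin n → ℕ}
    {N : Fin n → Fin n → Fin n → ℕ} (cls : ℕ → Fin n)
    (hcls : ∀ i < μ.colLen 0, μ.rowLen i = blockEnd w (cls i))
    (hN : IsOutline w (fun x => {i ∈ Finset.range (μ.colLen 0) | cls i = x}.card) N) :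
    μ.IsLatin := by
  let s x := {i ∈ Finset.range (μ.colLen 0) | cls i = x}
  let deg i x := if i ≤ x then (s x).card else 0
  have hdeg : ∀ k x, deg (blockIndex w k) x =
      (s x).card * if (k : ℕ) < blockEnd w x then 1 else 0 := fun k x => by
    simp only [deg, blockIndex_le_iff, mul_ite, mul_one, mul_zero]
  obtain ⟨A, hA, hAcol, hAsym⟩ := exists_partial_detachment (blockIndex w) (blockIndex w) N deg deg
    (by simpa only [card_blockIndex_eq] using hN.cell_le)
    (by simpa only [card_blockIndex_eq] using hN.row_sum)
    (by simpa only [card_blockIndex_eq] using hN.col_sum)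
  choose D hD hDcol hDsym using fun x => exists_balanced_decomposition (s x) _ _
    (fun k l => A k l x) (fun k => (hAcol k x).trans (hdeg k x))
    (fun l => (hAsym l x).trans (hdeg l x))
  have hmem : ∀ i < μ.colLen 0, i ∈ s (cls i) := fun i hi =>
    Finset.mem_filter.2 ⟨Finset.mem_range.2 hi, rfl⟩
  refine isLatin_of_disjoint_matchings μ (a := ∑ x, w x) (fun i hi => ?_) (fun i => D (cls i) i)
    (fun i hi j => ?_) (fun i hi j => ?_) fun j l => ?_
  · rw [hcls i hi]
    exact Finset.sum_le_univ_sum_of_nonneg fun _ => Nat.zero_le _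
  · rw [hDcol _ _ (hmem i hi), hcls i hi]
  · rw [hDsym _ _ (hmem i hi), hcls i hi]
  · calc ∑ i ∈ Finset.range (μ.colLen 0), D (cls i) i j l
        = ∑ x, ∑ i ∈ s x, D (cls i) i j l := (Finset.sum_fiberwise _ _ _).symm
      _ = ∑ x, ∑ i ∈ s x, D x i j l := Finset.sum_congr rfl fun x _ =>
          Finset.sum_congr rfl fun i hi => by rw [(Finset.mem_filter.1 hi).2]
      _ ≤ 1 := by simpa only [hD] using hA j l

theorem sum_range_colLen (μ : YoungDiagram) (k : ℕ) :
    ∑ j ∈ Finset.range k, μ.colLen j =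
      ∑ i ∈ Finset.range (μ.colLen 0), min (μ.rowLen i) k := by
  have hcol : ∀ j, μ.colLen j =
      ∑ i ∈ Finset.range (μ.colLen 0), if j < μ.rowLen i then 1 else 0 := fun j => by
    rw [← Finset.card_filter, ← Finset.card_range (μ.colLen j)]
    congr 1
    ext i
    rw [Finset.mem_filter, Finset.mem_range, Finset.mem_range, ← YoungDiagram.mem_iff_lt_rowLen,
      YoungDiagram.mem_iff_lt_colLen]
    exact ⟨fun hi => ⟨hi.trans_le (μ.colLen_anti 0 j (Nat.zero_le j)), hi⟩, And.right⟩
  have hmin : ∀ l, ∑ j ∈ Finset.range k, (if j < l then 1 else 0) = min l k := fun l => by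
    rw [← Finset.card_filter, ← Finset.card_range (min l k)]
    congr 1
    ext j
    simp [and_comm]
  rw [Finset.sum_congr rfl fun j _ => hcol j, Finset.sum_comm]
  exact Finset.sum_congr rfl fun i _ => hmin _

theorem sum_range_rowLen_le (μ : YoungDiagram) (k m : ℕ) :
    ∑ i ∈ Finset.range k, μ.rowLen i ≤
      k * m + ∑ i ∈ Finset.range (μ.colLen 0), (μ.rowLen i - m) := by
  calc ∑ i ∈ Finset.range k, μ.rowLen i
      ≤ ∑ i ∈ Finset.range k, (m + (μ.rowLen i - m)) :=
        Finset.sum_le_sum fun i _ => le_add_tsub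
    _ = k * m + ∑ i ∈ Finset.range k, (μ.rowLen i - m) := by
        rw [Finset.sum_add_distrib, Finset.sum_const, Finset.card_range, smul_eq_mul]
    _ ≤ k * m + ∑ i ∈ Finset.range (μ.colLen 0), (μ.rowLen i - m) := by
        gcongr 1
        refine Finset.sum_le_sum_of_ne_zero fun i _ hi => ?_
        rw [Finset.mem_range, ← YoungDiagram.mem_iff_lt_colLen, YoungDiagram.mem_iff_lt_rowLen]
        omega

theorem exists_isRowSubdiagram (μ : YoungDiagram) {s : Finset ℕ}
    (hs : s ⊆ Finset.range (μ.colLen 0)) :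
    ∃ ν : YoungDiagram, ν.IsRowSubdiagram μ ∧ ∀ f : ℕ → ℕ,
      ∑ i ∈ Finset.range (ν.colLen 0), f (ν.rowLen i) = ∑ i ∈ s, f (μ.rowLen i) := by
  let rows := (List.range (μ.colLen 0)).filter (· ∈ s)
  have hsub : (rows.map μ.rowLen).Sublist μ.rowLens := List.filter_sublist.map _
  have hsorted := (μ.rowLens_sorted.pairwise.sublist hsub).sortedGE
  have hν : (YoungDiagram.ofRowLens _ hsorted).rowLens = rows.map μ.rowLen :=
    YoungDiagram.rowLens_ofRowLens_eq_self fun x hx => μ.pos_of_mem_rowLens x (hsub.mem hx)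
  refine ⟨.ofRowLens _ hsorted, by rwa [YoungDiagram.IsRowSubdiagram, hν], fun f => ?_⟩
  have hrows : rows.toFinset = s := by
    ext i
    simpa [rows] using fun hi => Finset.mem_range.1 (hs hi)
  rw [← List.toFinset_range, List.sum_toFinset _ List.nodup_range, ← hrows,
    List.sum_toFinset _ (List.nodup_range.filter _)]
  have hmap := congrArg (fun l => (l.map f).sum) hν
  rw [YoungDiagram.rowLens] at hmap
  simp only [List.map_map] at hmap
  exact hmap

theorem sum_min_rowLen_le_of_isWide {μ : YoungDiagram} (hμ : μ.IsWide) {s : Finset ℕ}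
    (hs : s ⊆ Finset.range (μ.colLen 0)) (k m : ℕ) :
    ∑ i ∈ s, min (μ.rowLen i) k ≤ k * m + ∑ i ∈ s, (μ.rowLen i - m) := by
  obtain ⟨ν, hνμ, hsum⟩ := exists_isRowSubdiagram μ hs
  rw [← hsum (min · k), ← hsum (· - m), ← sum_range_colLen]
  simpa only [YoungDiagram.rowLen_transpose] using
    ((hμ ν hνμ).2 k).trans (sum_range_rowLen_le ν k m)

theorem card_le_of_isWide {μ : YoungDiagram} (hμ : μ.IsWide) {s : Finset ℕ}
    (hs : s ⊆ Finset.range (μ.colLen 0)) {m : ℕ} (hm : ∀ i ∈ s, μ.rowLen i ≤ m) :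
    s.card ≤ m := by
  have hpos : ∀ i ∈ s, min (μ.rowLen i) 1 = 1 := fun i hi => by
    have : 0 < μ.rowLen i := by
      rw [← YoungDiagram.mem_iff_lt_rowLen, YoungDiagram.mem_iff_lt_colLen]
      exact Finset.mem_range.1 (hs hi)
    omega
  have hsub : ∀ i ∈ s, μ.rowLen i - m = 0 := fun i hi => Nat.sub_eq_zero_of_le (hm i hi)
  calc s.card = ∑ i ∈ s, min (μ.rowLen i) 1 := by
        rw [Finset.sum_congr rfl hpos, Finset.card_eq_sum_ones]
    _ ≤ 1 * m + ∑ i ∈ s, (μ.rowLen i - m) := sum_min_rowLen_le_of_isWide hμ hs 1 m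
    _ = m := by rw [Finset.sum_congr rfl hsub, Finset.sum_const_zero, add_zero, one_mul]

/-- The numerical content of wideness for a diagram that has, for each `x`, `mult x` rows of length
`w 0 + ⋯ + w x`: domination for all subdiagrams made up of all the rows of certain lengths. Here
`m` bounds the first `k` row lengths by `m + (length - m)`, and the second condition is `k = 1`. -/
structure IsWideProfile {n : ℕ} (w mult : Fin n → ℕ) : Prop where
  sum_min_le : ∀ (T : Finset (Fin n)) (k m : ℕ), ∑ x ∈ T, mult x * min (blockEnd w x) k ≤
    k * m + ∑ x ∈ T, mult x * (blockEnd w x - m)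
  sum_le : ∀ (T : Finset (Fin n)) (m : ℕ), (∀ x ∈ T, blockEnd w x ≤ m) → ∑ x ∈ T, mult x ≤ m

theorem isWideProfile_of_isWide {μ : YoungDiagram} (hμ : μ.IsWide) {n : ℕ} {w : Fin n → ℕ}
    (cls : ℕ → Fin n) (hcls : ∀ i < μ.colLen 0, μ.rowLen i = blockEnd w (cls i)) :
    IsWideProfile w fun x => {i ∈ Finset.range (μ.colLen 0) | cls i = x}.card := by
  let rows (T : Finset (Fin n)) := {i ∈ Finset.range (μ.colLen 0) | cls i ∈ T}
  have hrows : ∀ T, rows T ⊆ Finset.range (μ.colLen 0) := fun T => Finset.filter_subset _ _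
  have hlen : ∀ T, ∀ i ∈ rows T, μ.rowLen i = blockEnd w (cls i) := fun T i hi =>
    hcls i (Finset.mem_range.1 (hrows T hi))
  have hsum : ∀ T (f : ℕ → ℕ), ∑ x ∈ T,
      {i ∈ Finset.range (μ.colLen 0) | cls i = x}.card * f (blockEnd w x) =
        ∑ i ∈ rows T, f (μ.rowLen i) := fun T f => by
    rw [← Finset.sum_fiberwise_of_maps_to (g := cls) fun i hi => (Finset.mem_filter.1 hi).2]
    refine Finset.sum_congr rfl fun x hx => ?_
    have hfibre : {i ∈ rows T | cls i = x} = {i ∈ Finset.range (μ.colLen 0) | cls i = x} := by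
      rw [Finset.filter_filter]
      exact Finset.filter_congr fun i _ => ⟨And.right, fun h => ⟨h ▸ hx, h⟩⟩
    rw [← hfibre, ← smul_eq_mul, ← Finset.sum_const]
    refine Finset.sum_congr rfl fun i hi => ?_
    rw [hlen T i (Finset.mem_filter.1 hi).1, (Finset.mem_filter.1 hi).2]
  refine ⟨fun T k m => ?_, fun T m hm => ?_⟩
  · rw [hsum T (min · k), hsum T (· - m)]
    exact sum_min_rowLen_le_of_isWide hμ (hrows T) k m
  · have := hsum T fun _ => 1
    simp only [mul_one, ← Finset.card_eq_sum_ones] at this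
    rw [this]
    refine card_le_of_isWide hμ (hrows T) fun i hi => ?_
    rw [hlen T i hi]
    exact hm _ (Finset.mem_filter.1 hi).2

/-- The number of cells of an `X × Y` rectangle inside an `a × a` square that are left for the other
colours when a colour of degree `p` in every line of the square uses the least possible number
`p * (X + Y - a)` of cells of the rectangle (a vacuous bound if `X + Y ≤ a`). -/
def room (a p X Y : ℤ) : ℤ :=
  X * Y - p * (X + Y - a)

theorem room_comm (a p X Y : ℤ) : room a p X Y = room a p Y X := by
  unfold room
  ring

theorem le_room_add {K a p X Y g : ℤ} (hK : K ≤ room a p X Y) (hKY : K ≤ (a - p) * Y)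
    (hg : 0 ≤ g) (hXa : X + g ≤ a) : K ≤ room a p (X + g) Y := by
  rcases le_total p Y with hpY | hYp
  · calc K ≤ room a p X Y + g * (Y - p) :=
          le_add_of_le_of_nonneg hK (mul_nonneg hg (sub_nonneg.2 hpY))
      _ = room a p (X + g) Y := by unfold room; ring
  · calc K ≤ (a - p) * Y + (a - (X + g)) * (p - Y) :=
          le_add_of_le_of_nonneg hKY (mul_nonneg (sub_nonneg.2 hXa) (sub_nonneg.2 hYp))
      _ = room a p (X + g) Y := by unfold room; ring

theorem room_zero_nonneg {a p Y : ℤ} (hp : 0 ≤ p) (hYa : Y ≤ a) : 0 ≤ room a p 0 Y := by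
  rw [room, zero_mul, zero_add, zero_sub, ← mul_neg, neg_sub]
  exact mul_nonneg hp (sub_nonneg.2 hYa)

theorem room_nonneg {a p X Y : ℤ} (hp : 0 ≤ p) (hpa : p ≤ a) (hX : 0 ≤ X) (hXa : X ≤ a)
    (hY : 0 ≤ Y) (hYa : Y ≤ a) : 0 ≤ room a p X Y := by
  have := le_room_add (room_zero_nonneg hp hYa) (mul_nonneg (sub_nonneg.2 hpa) hY) hX
    (by rwa [zero_add])
  rwa [zero_add] at this

/-- Adding the empty line `t` to `R` does no harm: if `p ≤ w(S)` the room grows, and otherwise it is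
at least `(a - p) * w(S)`, which bounds the cells of `U` in the columns of `S`. -/
theorem sum_sum_le_room_of_notMem {ι : Type*} [Fintype ι] {w : ι → ℤ} {U : ι → ι → ℤ} {p : ℤ}
    {t : ι} (hw : ∀ i, 0 ≤ w i) (hU : ∀ i j, 0 ≤ U i j)
    (hcol : ∀ j, ∑ i, U i j ≤ (∑ i, w i - p) * w j) (ht : ∀ j, U t j = 0) {S : Finset ι}
    (hcut : ∀ R : Finset ι, t ∉ R →
      ∑ i ∈ R, ∑ j ∈ S, U i j ≤ room (∑ i, w i) p (∑ i ∈ R, w i) (∑ j ∈ S, w j))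
    (R : Finset ι) :
    ∑ i ∈ R, ∑ j ∈ S, U i j ≤ room (∑ i, w i) p (∑ i ∈ R, w i) (∑ j ∈ S, w j) := by
  classical
  by_cases htR : t ∈ R
  swap
  · exact hcut R htR
  have hsum : ∑ i ∈ R.erase t, ∑ j ∈ S, U i j = ∑ i ∈ R, ∑ j ∈ S, U i j :=
    Finset.sum_erase R (Finset.sum_eq_zero fun j _ => ht j)
  have hdeg : ∑ i ∈ R, ∑ j ∈ S, U i j ≤ (∑ i, w i - p) * ∑ j ∈ S, w j := by
    rw [Finset.sum_comm, Finset.mul_sum]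
    exact Finset.sum_le_sum fun j _ =>
      (Finset.sum_le_univ_sum_of_nonneg fun i => hU i j).trans (hcol j)
  have hwR : ∑ i ∈ R.erase t, w i + w t = ∑ i ∈ R, w i := Finset.sum_erase_add _ _ htR
  rw [← hwR]
  exact le_room_add (hsum ▸ hcut _ (Finset.notMem_erase t R)) hdeg (hw t)
    (hwR ▸ Finset.sum_le_univ_sum_of_nonneg hw)

theorem sum_sum_le_room {ι : Type*} [Fintype ι] {w : ι → ℤ} {U : ι → ι → ℤ} {p : ℤ}
    {t : ι} (hw : ∀ i, 0 ≤ w i) (hU : ∀ i j, 0 ≤ U i j) (hsymm : ∀ i j, U i j = U j i)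
    (hp : 0 ≤ p) (hcol : ∀ j, ∑ i, U i j ≤ (∑ i, w i - p) * w j) (ht : ∀ j, U t j = 0)
    (hcut : ∀ R S : Finset ι, R.Nonempty → S.Nonempty → t ∉ R → t ∉ S →
      ∑ i ∈ R, ∑ j ∈ S, U i j ≤ room (∑ i, w i) p (∑ i ∈ R, w i) (∑ j ∈ S, w j))
    (R S : Finset ι) :
    ∑ i ∈ R, ∑ j ∈ S, U i j ≤ room (∑ i, w i) p (∑ i ∈ R, w i) (∑ j ∈ S, w j) := by
  have hswap : ∀ R S : Finset ι, ∑ i ∈ R, ∑ j ∈ S, U i j = ∑ i ∈ S, ∑ j ∈ R, U i j :=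
    fun R S => by
      rw [Finset.sum_comm]
      exact Finset.sum_congr rfl fun i _ => Finset.sum_congr rfl fun j _ => hsymm j i
  have hzero : ∀ S : Finset ι, 0 ≤ room (∑ i, w i) p 0 (∑ j ∈ S, w j) := fun S =>
    room_zero_nonneg hp (Finset.sum_le_univ_sum_of_nonneg hw)
  refine sum_sum_le_room_of_notMem hw hU hcol ht (fun R hR => ?_) R
  rw [hswap, room_comm]
  refine sum_sum_le_room_of_notMem hw hU hcol ht (fun S hS => ?_) S
  rcases S.eq_empty_or_nonempty with rfl | hS₀
  · simpa using hzero R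
  rcases R.eq_empty_or_nonempty with rfl | hR₀
  · simpa [room_comm] using hzero S
  exact hcut S R hS₀ hR₀ hS hR

theorem exists_regular_colour {ι : Type*} [Fintype ι] {w : ι → ℕ} {U : ι → ι → ℕ} {p : ℕ}
    (hU : ∀ i j, U i j ≤ w i * w j)
    (hcut : ∀ R S : Finset ι, (∑ i ∈ R, ∑ j ∈ S, U i j : ℤ) ≤
      room (∑ i, (w i : ℤ)) p (∑ i ∈ R, (w i : ℤ)) (∑ j ∈ S, (w j : ℤ))) :
    ∃ x : ι → ι → ℕ, (∀ i j, U i j + x i j ≤ w i * w j) ∧ (∀ i, ∑ j, x i j = w i * p) ∧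
      ∀ j, ∑ i, x i j = w j * p := by
  obtain ⟨x, hx, hrow, hcol⟩ := exists_capacitated_transport (fun i j => w i * w j - U i j)
    (fun i => w i * p) (fun j => w j * p) rfl fun R S => by
      have hsub : ∀ i j, ((w i * w j - U i j : ℕ) : ℤ) = w i * w j - U i j := fun i j => by
        rw [Nat.cast_sub (hU i j), Nat.cast_mul]
      have h := hcut R S
      zify
      simp only [hsub, Finset.sum_sub_distrib, ← Finset.mul_sum, ← Finset.sum_mul]
      unfold room at h
      linarith
  exact ⟨x, fun i j => by have := hx i j; have := hU i j; omega, hrow, hcol⟩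

/-- The instances of wideness that are needed for three row lengths `c < c + e < c + e + g` of
multiplicities `r`, `q`, `p`. In the outline square, block `0` consists of the lines `< c`, and
block `1` of the next `e` lines. -/
structure IsWideTriple (c e g p q r : ℤ) : Prop where
  c_nonneg : 0 ≤ c
  e_nonneg : 0 ≤ e
  g_nonneg : 0 ≤ g
  p_nonneg : 0 ≤ p
  q_nonneg : 0 ≤ q
  r_nonneg : 0 ≤ r
  p_add_q_add_r_le : p + q + r ≤ c + e + g
  q_add_r_le : q + r ≤ c + e
  r_le : r ≤ c
  sum_le_room : c * r + (c + e) * q ≤ room (c + e + g) p (c + e) (c + e)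
  sum_row_zero_le_room : c * (q + r) ≤ room (c + e + g) p c (c + e)
  sum_row_zero_le_add_room : c * (q + r) ≤ q * e + room (c + e + g) p c c
  sum_row_zero_le_add_sq : c * (q + r) ≤ q * e + c * c

namespace IsWideTriple

variable {c e g p q r b : ℤ}

theorem p_le (h : IsWideTriple c e g p q r) : p ≤ c + e + g := by
  linarith [h.p_add_q_add_r_le, h.q_nonneg, h.r_nonneg]

theorem e_le (h : IsWideTriple c e g p q r) : e ≤ c + e + g := by
  linarith [h.c_nonneg, h.g_nonneg]

theorem sum_row_one_le_room (h : IsWideTriple c e g p q r) :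
    e * q ≤ room (c + e + g) p e (c + e) := by
  have hsum := h.sum_le_room
  unfold room at hsum ⊢
  rcases le_total (p + q) (c + e) with hpq | hpq
  · linarith [mul_nonneg h.e_nonneg (sub_nonneg.2 hpq), mul_nonneg h.p_nonneg h.g_nonneg]
  · linarith [mul_nonneg h.c_nonneg (sub_nonneg.2 hpq), mul_nonneg h.c_nonneg h.r_nonneg]

theorem sum_row_zero_sub_le_room (h : IsWideTriple c e g p q r)
    (hb : b = c * q ∨ b = e * q ∨ b = c * e) :
    c * (q + r) - b ≤ room (c + e + g) p c c := by
  rcases hb with rfl | rfl | rfl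
  · rcases le_total c e with hce | hec
    · unfold room
      linarith [mul_nonneg h.p_nonneg (sub_nonneg.2 hce), mul_nonneg h.p_nonneg h.g_nonneg,
        mul_nonneg h.c_nonneg (sub_nonneg.2 h.r_le)]
    · linarith [h.sum_row_zero_le_add_room, mul_nonneg h.q_nonneg (sub_nonneg.2 hec)]
  · linarith [h.sum_row_zero_le_add_room]
  · have := h.sum_row_zero_le_room
    unfold room at this ⊢
    linarith [mul_nonneg h.p_nonneg h.e_nonneg]

theorem sum_row_zero_sub_le_sq (h : IsWideTriple c e g p q r)
    (hb : b = c * q ∨ b = e * q ∨ b = c * e) : c * (q + r) - b ≤ c * c := by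
  rcases hb with rfl | rfl | rfl
  · linarith [mul_nonneg h.c_nonneg (sub_nonneg.2 h.r_le)]
  · linarith [h.sum_row_zero_le_add_sq]
  · linarith [mul_nonneg h.c_nonneg (sub_nonneg.2 h.q_add_r_le)]

theorem sum_row_one_sub_le_room (h : IsWideTriple c e g p q r)
    (hb : b = c * q ∨ b = e * q ∨ b = c * e) :
    e * q - b ≤ room (c + e + g) p e e := by
  have hsum := h.sum_le_room
  have hrow := h.sum_row_one_le_room
  unfold room at hsum hrow ⊢
  rcases hb with rfl | rfl | rfl
  · have hcc := mul_self_nonneg c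
    rcases le_total (c + e) (p + q) with hpq | hpq
    · linarith [mul_nonneg h.c_nonneg (sub_nonneg.2 hpq), mul_nonneg h.c_nonneg h.r_nonneg]
    rcases le_total c e with hce | hec
    · linarith [mul_nonneg (sub_nonneg.2 hce) (sub_nonneg.2 hpq), mul_nonneg h.p_nonneg h.g_nonneg]
    · linarith [mul_nonneg (add_nonneg h.p_nonneg h.q_nonneg) (sub_nonneg.2 hec),
        mul_self_nonneg e, mul_nonneg h.p_nonneg h.g_nonneg]
  · rw [sub_self]
    exact room_nonneg h.p_nonneg h.p_le h.e_nonneg h.e_le h.e_nonneg h.e_le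
  · linarith [mul_nonneg h.p_nonneg h.c_nonneg]

theorem sum_row_one_sub_le_sq (h : IsWideTriple c e g p q r)
    (hb : b = c * q ∨ b = e * q ∨ b = c * e) : e * q - b ≤ e * e := by
  have hq : q ≤ c + e := by linarith [h.q_add_r_le, h.r_nonneg]
  rcases hb with rfl | rfl | rfl
  · rcases le_total c e with hce | hec
    · linarith [mul_nonneg (sub_nonneg.2 hce) (sub_nonneg.2 hq), mul_self_nonneg c]
    · linarith [mul_nonneg h.q_nonneg (sub_nonneg.2 hec), mul_self_nonneg e]
  · linarith [mul_self_nonneg e]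
  · linarith [mul_nonneg h.e_nonneg (sub_nonneg.2 hq)]

end IsWideTriple

theorem exists_corner_colour {c e g p u b v : ℕ}
    (hu : u ≤ c * c) (hb : b ≤ c * e) (hv : v ≤ e * e)
    (hp : p ≤ c + e + g) (hdeg₀ : (u + b : ℤ) ≤ (c + e + g - p) * c)
    (hdeg₁ : (b + v : ℤ) ≤ (c + e + g - p) * e)
    (h₀₀ : (u : ℤ) ≤ room (c + e + g) p c c) (h₀₁ : (b : ℤ) ≤ room (c + e + g) p c e)
    (h₁₁ : (v : ℤ) ≤ room (c + e + g) p e e) (h₀ : (u + b : ℤ) ≤ room (c + e + g) p c (c + e))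
    (h₁ : (b + v : ℤ) ≤ room (c + e + g) p e (c + e))
    (h : ((u + b) + (b + v) : ℤ) ≤ room (c + e + g) p (c + e) (c + e)) :
    ∃ x : Fin 3 → Fin 3 → ℕ,
      (∀ i j, !![u, b, 0; b, v, 0; 0, 0, 0] i j + x i j ≤ ![c, e, g] i * ![c, e, g] j) ∧
      (∀ i, ∑ j, x i j = ![c, e, g] i * p) ∧ ∀ j, ∑ i, x i j = ![c, e, g] j * p := by
  have hcells : ∀ i j, !![u, b, 0; b, v, 0; 0, 0, 0] i j ≤ ![c, e, g] i * ![c, e, g] j := by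
    intro i j
    fin_cases i <;> fin_cases j <;> simp [hu, hb, hv, mul_comm e c]
  refine exists_regular_colour hcells fun R S => ?_
  have hsubsets : ∀ R : Finset (Fin 3), R.Nonempty → 2 ∉ R → R = {0} ∨ R = {1} ∨ R = {0, 1} := by
    decide
  have h₁₀ := room_comm _ _ _ _ ▸ h₀₁
  have h₀' := room_comm _ _ _ _ ▸ h₀
  have h₁' := room_comm _ _ _ _ ▸ h₁
  refine sum_sum_le_room (t := 2) (fun _ => Nat.cast_nonneg _) (fun _ _ => Nat.cast_nonneg _)
    (fun i j => ?_) (Nat.cast_nonneg _) (fun j => ?_) (fun j => ?_)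
    (fun R S hR₀ hS₀ hR hS => ?_) R S
  · fin_cases i <;> fin_cases j <;> rfl
  · have hdeg₂ : (0 : ℤ) ≤ (c + e + g - p) * g :=
      mul_nonneg (sub_nonneg.2 (mod_cast hp)) (Nat.cast_nonneg g)
    fin_cases j <;> simp [Fin.sum_univ_three, hdeg₀, hdeg₁, hdeg₂]
  · fin_cases j <;> rfl
  · rcases hsubsets R hR₀ hR with rfl | rfl | rfl <;>
      rcases hsubsets S hS₀ hS with rfl | rfl | rfl <;>
      simp [Fin.sum_univ_three, *]

theorem IsWideTriple.exists_offDiagonal {c e g p q r : ℤ} (h : IsWideTriple c e g p q r) :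
    ∃ b, 0 ≤ b ∧ b ≤ c * q ∧ b ≤ e * q ∧ b ≤ c * e ∧
      c * (q + r) - b ≤ c * c ∧ c * (q + r) - b ≤ room (c + e + g) p c c ∧
      e * q - b ≤ e * e ∧ e * q - b ≤ room (c + e + g) p e e := by
  -- The middle colour is put off the diagonal as far as it fits.
  let b := min (c * q) (min (e * q) (c * e))
  have hb : b = c * q ∨ b = e * q ∨ b = c * e := by
    rcases min_choice (c * q) (min (e * q) (c * e)) with hmin | hmin
    · exact .inl hmin
    · exact .inr ((min_choice (e * q) (c * e)).imp hmin.trans hmin.trans)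
  have hb₀ : 0 ≤ b := le_min (mul_nonneg h.c_nonneg h.q_nonneg)
    (le_min (mul_nonneg h.e_nonneg h.q_nonneg) (mul_nonneg h.c_nonneg h.e_nonneg))
  exact ⟨b, hb₀, min_le_left _ _, (min_le_right _ _).trans (min_le_left _ _),
    (min_le_right _ _).trans (min_le_right _ _), h.sum_row_zero_sub_le_sq hb,
    h.sum_row_zero_sub_le_room hb, h.sum_row_one_sub_le_sq hb, h.sum_row_one_sub_le_room hb⟩

theorem blockEnd_fin_three (w : Fin 3 → ℕ) :
    blockEnd w = ![w 0, w 0 + w 1, w 0 + w 1 + w 2] := by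
  ext x
  fin_cases x
  · exact Finset.sum_singleton w 0
  · exact Finset.sum_pair (show (0 : Fin 3) ≠ 1 by decide)
  · exact Fin.sum_univ_three w

theorem IsWideProfile.isWideTriple {w mult : Fin 3 → ℕ} (h : IsWideProfile w mult) :
    IsWideTriple (w 0) (w 1) (w 2) (mult 2) (mult 1) (mult 0) := by
  have hend₀ : blockEnd w 0 = w 0 := congrFun (blockEnd_fin_three w) 0
  have hend₁ : blockEnd w 1 = w 0 + w 1 := congrFun (blockEnd_fin_three w) 1
  have hend₂ : blockEnd w 2 = w 0 + w 1 + w 2 := congrFun (blockEnd_fin_three w) 2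
  have hsum₂ : ∀ f : Fin 3 → ℕ, ∑ x ∈ {0, 1}, f x = f 0 + f 1 := fun f =>
    Finset.sum_pair (by decide)
  have sum_le : mult 0 + mult 1 + mult 2 ≤ w 0 + w 1 + w 2 := by
    rw [← Fin.sum_univ_three, ← Fin.sum_univ_three]
    exact h.sum_le _ _ fun x _ => Finset.sum_le_sum_of_subset (Finset.subset_univ _)
  have sum_le' : mult 0 + mult 1 ≤ w 0 + w 1 := by
    rw [← hsum₂]
    exact h.sum_le _ _ (by simp [hend₀, hend₁])
  have le : mult 0 ≤ w 0 := by
    rw [← Finset.sum_singleton mult]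
    exact h.sum_le _ _ (by simp [hend₀])
  have hlen₀ : min (w 0 + w 1 + w 2) (w 0) = w 0 := min_eq_right (by omega)
  have hlen₁ : w 0 + w 1 + w 2 - w 0 = w 1 + w 2 := by omega
  have h₁₁ : mult 0 * w 0 + mult 1 * (w 0 + w 1) + mult 2 * (w 0 + w 1) ≤
      (w 0 + w 1) * (w 0 + w 1) + mult 2 * w 2 := by
    simpa [Fin.sum_univ_three, hend₀, hend₁, hend₂] using h.sum_min_le .univ (w 0 + w 1) (w 0 + w 1)
  have h₀₁ : mult 0 * w 0 + mult 1 * w 0 + mult 2 * w 0 ≤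
      w 0 * (w 0 + w 1) + mult 2 * w 2 := by
    simpa [Fin.sum_univ_three, hend₀, hend₁, hend₂, hlen₀] using
      h.sum_min_le .univ (w 0) (w 0 + w 1)
  have h₀₀ : mult 0 * w 0 + mult 1 * w 0 + mult 2 * w 0 ≤
      w 0 * w 0 + (mult 1 * w 1 + mult 2 * (w 1 + w 2)) := by
    simpa [Fin.sum_univ_three, hend₀, hend₁, hend₂, hlen₀, hlen₁] using
      h.sum_min_le .univ (w 0) (w 0)
  have h₀₀' : mult 0 * w 0 + mult 1 * w 0 ≤ w 0 * w 0 + mult 1 * w 1 := by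
    simpa [hsum₂, hend₀, hend₁] using h.sum_min_le {0, 1} (w 0) (w 0)
  zify at sum_le sum_le' le h₁₁ h₀₁ h₀₀ h₀₀'
  constructor
  case p_add_q_add_r_le => linarith
  case q_add_r_le => linarith
  case r_le => exact le
  case sum_row_zero_le_add_sq => linarith
  case sum_le_room => unfold room; linarith
  case sum_row_zero_le_room => unfold room; linarith
  case sum_row_zero_le_add_room => unfold room; linarith
  all_goals exact Nat.cast_nonneg _

theorem IsWideTriple.exists_colours {c e g p q r : ℕ} (h : IsWideTriple c e g p q r) :
    ∃ (s b t : ℕ) (x : Fin 3 → Fin 3 → ℕ), s + b = c * q ∧ b + t = e * q ∧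
      (∀ i j, !![c * r + s, b, 0; b, t, 0; 0, 0, 0] i j + x i j ≤
        ![c, e, g] i * ![c, e, g] j) ∧
      (∀ i, ∑ j, x i j = ![c, e, g] i * p) ∧ ∀ j, ∑ i, x i j = ![c, e, g] j * p := by
  obtain ⟨b, hb, hbc, hbe, hbce, hsq₀, hroom₀, hsq₁, hroom₁⟩ := h.exists_offDiagonal
  lift b to ℕ using hb
  obtain ⟨s, hs⟩ := Nat.exists_eq_add_of_le' (mod_cast hbc : b ≤ c * q)
  obtain ⟨t, ht⟩ := Nat.exists_eq_add_of_le (mod_cast hbe : b ≤ e * q)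
  have hdeg₀ : 0 ≤ (c : ℤ) * (c + e + g - (p + q + r)) :=
    mul_nonneg h.c_nonneg (sub_nonneg.2 h.p_add_q_add_r_le)
  have hdeg₁ : 0 ≤ (e : ℤ) * (c + e + g - (p + q + r)) :=
    mul_nonneg h.e_nonneg (sub_nonneg.2 h.p_add_q_add_r_le)
  have hpg : 0 ≤ (p * g : ℤ) := mul_nonneg h.p_nonneg h.g_nonneg
  have her : 0 ≤ (e * r : ℤ) := mul_nonneg h.e_nonneg h.r_nonneg
  have hroom₀₁ : (b : ℤ) ≤ room (c + e + g) p c e := by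
    unfold room
    linarith
  have := h.p_le
  have := h.sum_row_zero_le_room
  have := h.sum_row_one_le_room
  have := h.sum_le_room
  zify at hs ht
  refine ⟨s, b, t, ?_⟩
  simp only [exists_and_left]
  refine ⟨mod_cast hs.symm, mod_cast ht.symm, ?_⟩
  apply exists_corner_colour <;> push_cast <;> linarith

theorem exists_isOutline_of_isWideProfile {w mult : Fin 3 → ℕ} (h : IsWideProfile w mult) :
    ∃ N, IsOutline w mult N := by
  obtain ⟨c, e, g, rfl⟩ : ∃ c e g, w = ![c, e, g] :=
    ⟨w 0, w 1, w 2, by ext i; fin_cases i <;> rfl⟩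
  obtain ⟨r, q, p, rfl⟩ : ∃ r q p, mult = ![r, q, p] :=
    ⟨mult 0, mult 1, mult 2, by ext i; fin_cases i <;> rfl⟩
  have ht : IsWideTriple (c : ℤ) e g p q r := h.isWideTriple
  obtain ⟨s, b, t, x, hs, ht, hx, hrow, hcol⟩ := ht.exists_colours
  refine ⟨fun i j => ![!![c * r, 0, 0; 0, 0, 0; 0, 0, 0] i j, !![s, b, 0; b, t, 0; 0, 0, 0] i j,
    x i j], ⟨fun i j => ?_, fun i y => ?_, fun j y => ?_⟩⟩
  · refine le_trans (le_of_eq ?_) (hx i j)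
    fin_cases i <;> fin_cases j <;> simp [Fin.sum_univ_three]
  · fin_cases y
    · fin_cases i <;> simp [Fin.sum_univ_three]
    · fin_cases i <;> simp [Fin.sum_univ_three, hs, ht]
    · simpa [show i ≤ 2 from Fin.le_last i] using hrow i
  · fin_cases y
    · fin_cases j <;> simp [Fin.sum_univ_three]
    · fin_cases j <;> simp [Fin.sum_univ_three, hs, ht]
    · simpa [show j ≤ 2 from Fin.le_last j] using hcol j

theorem exists_blockEnd_eq (s : Finset ℕ) (hs : s.card ≤ 3) :
    ∃ w : Fin 3 → ℕ, ∀ l ∈ s, ∃ x, l = blockEnd w x := by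
  obtain ⟨t, hst, ht⟩ := Infinite.exists_superset_card_eq s 3 hs
  let ℓ := t.orderEmbOfFin ht
  refine ⟨![ℓ 0, ℓ 1 - ℓ 0, ℓ 2 - ℓ 1], fun l hl => ?_⟩
  obtain ⟨x, rfl⟩ : l ∈ Set.range ℓ := by
    rw [Finset.range_orderEmbOfFin]
    exact hst hl
  refine ⟨x, ?_⟩
  rw [blockEnd_fin_three]
  fin_cases x <;> simp

theorem toFinset_rowLens_ofRowLens_subset (l : List ℕ) (hl : l.SortedGE) :
    (YoungDiagram.ofRowLens l hl).rowLens.toFinset ⊆ l.toFinset := by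
  intro x hx
  rw [List.mem_toFinset] at hx ⊢
  obtain ⟨i, hi, rfl⟩ := List.mem_map.1 hx
  rw [List.mem_range, ← YoungDiagram.mem_iff_lt_colLen, YoungDiagram.mem_ofRowLens] at hi
  obtain ⟨hi, -⟩ := hi
  rw [YoungDiagram.rowLen_ofRowLens ⟨i, hi⟩]
  exact List.getElem_mem hi

theorem theorem1p1_general (μ : YoungDiagram) (hcard : μ.rowLens.toFinset.card ≤ 3)
    (hwide : μ.IsWide) : μ.IsLatin := by
  obtain ⟨w, hw⟩ := exists_blockEnd_eq _ hcard
  have hmem : ∀ i < μ.colLen 0, μ.rowLen i ∈ μ.rowLens.toFinset := fun i hi =>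
    List.mem_toFinset.2 (List.mem_map_of_mem (List.mem_range.2 hi))
  choose! cls hcls using fun i hi => hw _ (hmem i hi)
  obtain ⟨N, hN⟩ := exists_isOutline_of_isWideProfile (isWideProfile_of_isWide hwide cls hcls)
  exact isLatin_of_isOutline μ cls hcls hN

/-- Here `l` is the list of row lengths from top to bottom; as in a partition written
`0 ≤ l₁ ≤ ⋯ ≤ l_m`, the length `0` is allowed, and every Young diagram arises from such a list. -/
theorem theorem1p1 (l : List ℕ) (hl : l.SortedGE) (hthree : l.toFinset.card = 3)
    (hwide : (YoungDiagram.ofRowLens l hl).IsWide) :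
    (YoungDiagram.ofRowLens l hl).IsLatin := by
  have hcard := Finset.card_le_card (toFinset_rowLens_ofRowLens_subset l hl)
  exact theorem1p1_general _ (hcard.trans hthree.le) hwide
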